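/- Semigroups are nonempty. A \emph{pseudovariety of semigroups} is a class of finite semigroups closed under taking subsemigroups, homomorphic images and finitary direct products. A semigroup $S$ is \emph{equidivisible} if for all $u,v,x,y\in S$ with $uv=xy$, either $u=x$ and $v=y$, or there is $t\in S$ such that $ut=x$ and $v=ty$, or there is $t\in S$ such that $xt=u$ and $y=tv$. A pseudovariety $\mathsf V$ is \emph{equidivisible} if every finitely generated free pro-$\mathsf V$ semigroup is equidivisible, where the free pro-$\mathsf V$ semigroup over a finite nonempty set $A$ is the projective limit of all $A$-generated semigroups of $\mathsf V$, that is, of the quotients of the free semigroup $A^+$ that belong to $\mathsf V$. Let $\mathsf{LG}$ be the class of all finite semigroups $S$ whose local monoids $eSe$ ($e\in S$ idempotent) are groups, $\mathsf{LI}$ the class of all finite semigroups whose local monoids are trivial, and $\mathsf{CS}$ the class of all finite completely simple semigroups. \textbf{Theorem.} Let $\mathsf V$ be a pseudovariety of semigroups contained in $\mathsf{LG}$. Then $\mathsf V$ is equidivisible if and only if $\mathsf V\subseteq\mathsf{CS}$ or $\mathsf{LI}\subseteq\mathsf V$. -/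

import Mathlib

universe u

/-- A semigroup `S` is equidivisible if `u * v = x * y` implies that `u = x` and `v = y`, or that
there is `t` with `u * t = x` and `v = t * y`, or that there is `t` with `x * t = u` and
`y = t * v`. -/
def IsEquidivisible (S : Type u) [Semigroup S] : Prop :=
  ∀ u v x y : S, u * v = x * y →
    (u = x ∧ v = y) ∨ (∃ t : S, u * t = x ∧ v = t * y) ∨ (∃ t : S, x * t = u ∧ y = t * v)

/-- A pseudovariety of semigroups: a class of finite (nonempty) semigroups that is closed under
taking (nonempty) subsemigroups, homomorphic images and finitary direct products. The empty
product is allowed, so that the one-element semigroups belong to every pseudovariety. -/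
structure Pseudovariety where
  /-- The semigroup `S` belongs to the class. -/
  Mem : (S : Type u) → [Semigroup S] → Prop
  finite_of_mem : ∀ (S : Type u) [Semigroup S], Mem S → Finite S
  nonempty_of_mem : ∀ (S : Type u) [Semigroup S], Mem S → Nonempty S
  subsemigroup_mem : ∀ (S : Type u) [Semigroup S] (T : Subsemigroup S),
    Nonempty T → Mem S → Mem T
  image_mem : ∀ (S T : Type u) [Semigroup S] [Semigroup T] (f : S →ₙ* T),
    Function.Surjective f → Mem S → Mem T
  pi_mem : ∀ (ι : Type) [Finite ι] (S : ι → Type u) [∀ i, Semigroup (S i)],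
    (∀ i, Mem (S i)) → Mem (∀ i, S i)

/-- The class `LG` of the finite local groups: the finite semigroups all of whose local monoids
`eSe`, with `e` idempotent, are groups. (`Subsemigroup.corner e` is `eSe`; its identity element
is `e`.) -/
def IsFiniteLocalGroup (S : Type u) [Semigroup S] : Prop :=
  Finite S ∧ Nonempty S ∧ ∀ e : S, IsIdempotentElem e →
    ∀ x ∈ Subsemigroup.corner e, ∃ y ∈ Subsemigroup.corner e, x * y = e ∧ y * x = e

/-- The class `LI` of the finite locally trivial semigroups: the finite semigroups all of whose
local monoids `eSe`, with `e` idempotent, are trivial. -/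
def IsFiniteLocallyTrivial (S : Type u) [Semigroup S] : Prop :=
  Finite S ∧ Nonempty S ∧ ∀ e : S, IsIdempotentElem e → ∀ x ∈ Subsemigroup.corner e, x = e

/-- A semigroup is simple if it is its only nonempty two-sided ideal. -/
def SemigroupIsSimple (S : Type u) [Semigroup S] : Prop :=
  Nonempty S ∧ ∀ I : Set S, I.Nonempty → (∀ s, ∀ a ∈ I, s * a ∈ I ∧ a * s ∈ I) → I = Set.univ

/-- An idempotent `e` is primitive if it is minimal for the natural order of idempotents, where
`f ≤ e` means `e * f = f` and `f * e = f`. -/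
def IsPrimitiveIdempotent {S : Type u} [Semigroup S] (e : S) : Prop :=
  IsIdempotentElem e ∧ ∀ f : S, IsIdempotentElem f → e * f = f → f * e = f → f = e

/-- The class `CS` of the finite completely simple semigroups: the finite simple semigroups that
have a primitive idempotent. -/
def IsFiniteCompletelySimple (S : Type u) [Semigroup S] : Prop :=
  Finite S ∧ SemigroupIsSimple S ∧ ∃ e : S, IsPrimitiveIdempotent e

/-- The canonical homomorphism `M ⧸ c → M ⧸ d` for congruences `c ≤ d` on a semigroup `M`. -/
def conTransition {M : Type u} [Semigroup M] {c d : Con M} (h : c ≤ d) :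
    c.Quotient →ₙ* d.Quotient where
  toFun := Quotient.map' id fun _ _ hxy => h hxy
  map_mul' := by
    rintro ⟨x⟩ ⟨y⟩
    rfl

namespace Pseudovariety

/-- The congruences on the free semigroup `A⁺` whose quotient belongs to `V`. The quotients by
them are, up to isomorphism, the `A`-generated semigroups of `V`. -/
def FreeCon (V : Pseudovariety.{u}) (A : Type u) : Type u :=
  {c : Con (FreeSemigroup A) // V.Mem c.Quotient}

/-- The free pro-`V` semigroup over a finite set `A`: the projective limit of all `A`-generated
semigroups of `V`, i.e. the semigroup of all families `(x_c)`, with `x_c ∈ A⁺ ⧸ c`, that are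
compatible with the canonical homomorphisms `A⁺ ⧸ c → A⁺ ⧸ d` for `c ≤ d`. -/
def freePro (V : Pseudovariety.{u}) (A : Type u) :
    Subsemigroup (∀ c : V.FreeCon A, c.1.Quotient) where
  carrier := {x | ∀ (c d : V.FreeCon A) (h : c.1 ≤ d.1), conTransition h (x c) = x d}
  mul_mem' := by
    intro x y hx hy c d h
    rw [Pi.mul_apply, Pi.mul_apply, map_mul, hx c d h, hy c d h]

/-- A pseudovariety `V` is equidivisible if every finitely generated free pro-`V` semigroup is
equidivisible. -/
def Equidivisible (V : Pseudovariety.{u}) : Prop :=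
  ∀ (A : Type u) [Finite A] [Nonempty A], IsEquidivisible (V.freePro A)

end Pseudovariety

/-!
The values of all words longer than a finite local group lie in its minimal ideal, and there two
factorizations `u * v = x * y` have a common refinement as soon as `v` and `x` lie in that ideal. In
particular completely simple semigroups are equidivisible. By compactness, the free pro-`V`
semigroup over `A` is equidivisible if and only if for each congruence `c` on `A⁺` with quotient in
`V` there is another one, `d`, such that factorizations of words that agree modulo `d` have a common
refinement modulo `c`. If `LI ⊆ V`, then `d` can be chosen to remember long prefixes and suffixes,
which settles the factorizations with a short factor; the others are settled in the minimal ideal.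

Conversely, a local group that is not completely simple has an element that is not a product. If `V`
contains such a semigroup, some quotient of `A⁺` in `V` separates the letters from all other words,
so a common refinement of two factorizations that begin with letters identifies these letters and
the remainders. Cancelling letters on both sides in this way yields congruences that recognize
prefixes and suffixes of any given length, and these determine the value of a word in a locally
trivial semigroup.
-/

open MulOpposite Function FreeSemigroup

section Equidivisibility

variable {S T : Type*} [Semigroup S] [Semigroup T]

/-- The factorizations `u * v` and `x * y` have a common refinement: `IsEquidivisible S` says that
any two factorizations of an element of `S` have one. -/
def EquidivisibleAt (u v x y : S) : Prop :=
  (u = x ∧ v = y) ∨ (∃ t : S, u * t = x ∧ v = t * y) ∨ (∃ t : S, x * t = u ∧ y = t * v)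

namespace EquidivisibleAt

variable {u v x y : S}

theorem symm (h : EquidivisibleAt u v x y) : EquidivisibleAt x y u v :=
  h.imp (fun h => ⟨h.1.symm, h.2.symm⟩) Or.symm

theorem map (f : S →ₙ* T) (h : EquidivisibleAt u v x y) :
    EquidivisibleAt (f u) (f v) (f x) (f y) := by
  rcases h with ⟨rfl, rfl⟩ | ⟨t, rfl, rfl⟩ | ⟨t, rfl, rfl⟩
  · exact Or.inl ⟨rfl, rfl⟩
  · exact Or.inr (Or.inl ⟨f t, (map_mul f u t).symm, map_mul f t y⟩)
  · exact Or.inr (Or.inr ⟨f t, (map_mul f x t).symm, map_mul f t v⟩)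

theorem of_op (h : EquidivisibleAt (op v) (op u) (op y) (op x)) : EquidivisibleAt u v x y := by
  rcases h with ⟨hv, hu⟩ | ⟨t, hy, hu⟩ | ⟨t, hv, hx⟩
  · exact Or.inl ⟨op_injective hu, op_injective hv⟩
  · exact Or.inr (Or.inr ⟨t.unop, (congrArg unop hu).symm, (congrArg unop hy).symm⟩)
  · exact Or.inr (Or.inl ⟨t.unop, (congrArg unop hx).symm, (congrArg unop hv).symm⟩)

end EquidivisibleAt

end Equidivisibility

section FiniteSemigroup

variable {S : Type*} [Semigroup S]

theorem exists_isIdempotentElem_mem [Finite S] {s : Set S} (hs : s.Nonempty)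
    (hmul : ∀ x ∈ s, ∀ y ∈ s, x * y ∈ s) : ∃ e ∈ s, IsIdempotentElem e := by
  let _ : TopologicalSpace S := ⊥
  have : DiscreteTopology S := ⟨rfl⟩
  exact exists_idempotent_in_compact_subsemigroup (fun _ => continuous_of_discreteTopology) s hs
    s.toFinite.isCompact hmul

/-- The element `k` lies in the ideal of `S` generated by the idempotents. In a finite local group
this is the minimal ideal. -/
def HasIdempotentFactor (k : S) : Prop :=
  ∃ a e b : S, IsIdempotentElem e ∧ k = a * e * b

theorem HasIdempotentFactor.mul_right {k : S} (hk : HasIdempotentFactor k) (s : S) :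
    HasIdempotentFactor (k * s) := by
  obtain ⟨a, e, b, he, rfl⟩ := hk
  exact ⟨a, e, b * s, he, mul_assoc _ _ _⟩

theorem HasIdempotentFactor.mul_left {k : S} (hk : HasIdempotentFactor k) (s : S) :
    HasIdempotentFactor (s * k) := by
  obtain ⟨a, e, b, he, rfl⟩ := hk
  exact ⟨s * a, e, b, he, by simp only [mul_assoc]⟩

end FiniteSemigroup

theorem IsFiniteLocallyTrivial.isFiniteLocalGroup {S : Type u} [Semigroup S]
    (hS : IsFiniteLocallyTrivial S) : IsFiniteLocalGroup S := by
  refine ⟨hS.1, hS.2.1, fun e he x hx => ⟨x, hx, ?_⟩⟩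
  rw [hS.2.2 e he x hx]
  exact ⟨he, he⟩

theorem IsFiniteLocallyTrivial.mul_mul_eq_self {S : Type u} [Semigroup S]
    (hS : IsFiniteLocallyTrivial S) {e : S} (he : IsIdempotentElem e) (s : S) : e * s * e = e :=
  hS.2.2 e he _ ⟨s, rfl⟩

namespace IsFiniteLocalGroup

variable {S : Type u} [Semigroup S]

theorem op (hS : IsFiniteLocalGroup S) : IsFiniteLocalGroup Sᵐᵒᵖ := by
  obtain ⟨hfin, ⟨s⟩, hinv⟩ := hS
  refine ⟨.of_equiv S opEquiv, ⟨MulOpposite.op s⟩, ?_⟩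
  rintro e he _ ⟨s, rfl⟩
  obtain ⟨_, ⟨r, rfl⟩, hr, hr'⟩ := hinv e.unop (congrArg unop he) _ ⟨s.unop, rfl⟩
  refine ⟨e * MulOpposite.op r * e, ⟨_, rfl⟩, unop_injective ?_, unop_injective ?_⟩
  · simpa only [unop_mul, unop_op, mul_assoc] using hr'
  · simpa only [unop_mul, unop_op, mul_assoc] using hr

theorem exists_inverse (hS : IsFiniteLocalGroup S) {e : S} (he : IsIdempotentElem e) (s : S) :
    ∃ y, e * s * y = e ∧ y * s * e = e := by
  obtain ⟨_, ⟨r, rfl⟩, hr, hr'⟩ := hS.2.2 e he _ ⟨s, rfl⟩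
  refine ⟨e * r * e, ?_, ?_⟩
  · simpa only [← mul_assoc, he.mul_mul_self] using hr
  · simpa only [mul_assoc, he.mul_self_mul] using hr'

variable {k : S}

theorem exists_mul_mul_right_eq_self (hS : IsFiniteLocalGroup S) (hk : HasIdempotentFactor k)
    (s : S) : ∃ z, k * s * z = k := by
  obtain ⟨a, e, b, he, rfl⟩ := hk
  obtain ⟨y, hy, -⟩ := hS.exists_inverse he (b * s)
  refine ⟨y * b, ?_⟩
  calc a * e * b * s * (y * b) = a * (e * (b * s) * y) * b := by simp only [mul_assoc]
    _ = a * e * b := by rw [hy]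

theorem exists_mul_mul_left_eq_self (hS : IsFiniteLocalGroup S) (hk : HasIdempotentFactor k)
    (s : S) : ∃ z, z * s * k = k := by
  obtain ⟨a, e, b, he, rfl⟩ := hk
  obtain ⟨y, -, hy⟩ := hS.exists_inverse he (s * a)
  refine ⟨a * y, ?_⟩
  calc a * y * s * (a * e * b) = a * (y * (s * a) * e) * b := by simp only [mul_assoc]
    _ = a * e * b := by rw [hy]

theorem exists_mul_mul_self_eq (hS : IsFiniteLocalGroup S) (hk : HasIdempotentFactor k) :
    ∃ z, k * z * k = k := by
  obtain ⟨z, hz⟩ := hS.exists_mul_mul_right_eq_self hk k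
  obtain ⟨w, hw⟩ := hS.exists_mul_mul_left_eq_self hk k
  have hwz : w * k = k * z := by
    calc w * k = w * k * k * z := by rw [mul_assoc (w * k), mul_assoc w, ← mul_assoc k, hz]
      _ = k * z := by rw [hw]
  exact ⟨z, by rw [← hwz, hw]⟩

theorem exists_isIdempotentElem_mul_eq (hS : IsFiniteLocalGroup S) (hk : HasIdempotentFactor k) :
    ∃ e, IsIdempotentElem e ∧ e * k = k := by
  obtain ⟨z, hz⟩ := hS.exists_mul_mul_self_eq hk
  exact ⟨k * z, by rw [IsIdempotentElem, ← mul_assoc, hz], hz⟩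

theorem mul_left_cancel (hS : IsFiniteLocalGroup S) {e : S} (he : IsIdempotentElem e) {u a b : S}
    (ha : e * a = a) (hb : e * b = b) (h : u * a = u * b) : a = b := by
  obtain ⟨y, -, hy⟩ := hS.exists_inverse he u
  calc a = y * u * e * a := by rw [hy, ha]
    _ = y * u * e * b := by simp only [mul_assoc, ha, hb, h]
    _ = b := by rw [hy, hb]

theorem equidivisibleAt_of_hasIdempotentFactor (hS : IsFiniteLocalGroup S) {u v x y : S}
    (hv : HasIdempotentFactor v) (hx : HasIdempotentFactor x) (h : u * v = x * y) :
    EquidivisibleAt u v x y := by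
  obtain ⟨g, hg⟩ := hS.exists_mul_mul_self_eq (hv.mul_left u)
  obtain ⟨z, hz⟩ := hS.exists_mul_mul_right_eq_self hx y
  obtain ⟨w, hw⟩ := hS.exists_mul_mul_left_eq_self hv u
  rw [← h] at hz
  rw [mul_assoc] at hw
  refine Or.inr (Or.inl ⟨v * g * x, ?_, ?_⟩)
  · calc u * (v * g * x) = u * v * g * (u * v * z) := by rw [hz]; simp only [mul_assoc]
      _ = u * v * g * (u * v) * z := by simp only [mul_assoc]
      _ = x := by rw [hg, hz]
  · calc v = w * (u * v * g * (u * v)) := by rw [hg, hw]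
      _ = w * (u * v) * g * (x * y) := by rw [← h]; simp only [mul_assoc]
      _ = v * g * x * y := by rw [hw]; simp only [mul_assoc]

theorem isFiniteCompletelySimple_iff (hS : IsFiniteLocalGroup S) :
    IsFiniteCompletelySimple S ↔ ∀ k : S, HasIdempotentFactor k := by
  have := hS.1
  have := hS.2.1
  obtain ⟨e, -, he⟩ := exists_isIdempotentElem_mem (S := S) Set.univ_nonempty fun _ _ _ _ => trivial
  constructor
  · rintro ⟨-, ⟨-, hsimple⟩, -⟩ k
    have hideal : {k : S | HasIdempotentFactor k} = Set.univ :=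
      hsimple _ ⟨e * e * e, e, e, e, he, rfl⟩ fun s k hk => ⟨hk.mul_left s, hk.mul_right s⟩
    exact hideal.ge trivial
  · intro hfactor
    refine ⟨hS.1, ⟨hS.2.1, fun I ⟨i, hi⟩ hI => Set.eq_univ_of_forall fun k => ?_⟩, e, he, ?_⟩
    · obtain ⟨z, hz⟩ := hS.exists_mul_mul_right_eq_self (hfactor k) i
      exact hz ▸ (hI z _ (hI k i hi).1).2
    · intro f hf hef hfe
      obtain ⟨y, hy, -⟩ := hS.exists_inverse he f
      calc f = f * (e * f * y) := by rw [hy, hfe]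
        _ = e * f * y := by rw [hef, ← mul_assoc, hf]
        _ = e := hy

end IsFiniteLocalGroup

/-- The words over the alphabet `A`, that is, the elements of the free semigroup `A⁺`. -/
abbrev Word (A : Type*) : Type _ := FreeSemigroup A

namespace Word

variable {A : Type*}

/-- The nonempty list of the letters of a word. -/
def letters (w : Word A) : List A := w.head :: w.tail

theorem letters_mul (w w' : Word A) : letters (w * w') = letters w ++ letters w' := rfl

theorem length_letters (w : Word A) : (letters w).length = w.length := rfl

theorem letters_injective : Injective (letters (A := A)) := by
  rintro ⟨a, l⟩ ⟨b, l'⟩ h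
  obtain ⟨rfl, rfl⟩ := List.cons.inj h
  rfl

theorem exists_letters_eq {l : List A} (hl : l ≠ []) : ∃ w : Word A, letters w = l := by
  obtain ⟨a, l, rfl⟩ := List.exists_cons_of_ne_nil hl
  exact ⟨⟨a, l⟩, rfl⟩

theorem eq_or_exists_eq_mul_of_prefix {p w : Word A} (h : letters p <+: letters w) :
    w = p ∨ ∃ r, w = p * r := by
  obtain ⟨l, hl⟩ := h
  rcases eq_or_ne l [] with rfl | hne
  · rw [List.append_nil] at hl
    exact Or.inl (letters_injective hl.symm)
  · obtain ⟨r, rfl⟩ := exists_letters_eq hne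
    exact Or.inr ⟨r, letters_injective hl.symm⟩

theorem exists_eq_mul_of_prefix {p w : Word A} (h : letters p <+: letters w)
    (hlt : p.length < w.length) : ∃ r, w = p * r :=
  (eq_or_exists_eq_mul_of_prefix h).resolve_left (by rintro rfl; exact hlt.false)

theorem eq_of_or_eq_of_mul (w : Word A) : (∃ a, w = of a) ∨ ∃ a r, w = of a * r :=
  (eq_or_exists_eq_mul_of_prefix (p := of w.head) ⟨w.tail, rfl⟩).imp
    (fun h => ⟨_, h⟩) (fun h => ⟨_, h⟩)

theorem mul_ne_of (w w' : Word A) (a : A) : w * w' ≠ of a := fun h => by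
  have hlen := congrArg FreeSemigroup.length h
  rw [length_mul, length_of, FreeSemigroup.length, FreeSemigroup.length] at hlen
  omega

/-- The mirror image of words, as a homomorphism to the opposite semigroup. -/
def reverseHom : Word A →ₙ* (Word A)ᵐᵒᵖ := FreeSemigroup.lift fun a => op (of a)

/-- The mirror image of a word. -/
def reverse (w : Word A) : Word A := (reverseHom w).unop

theorem reverse_of (a : A) : reverse (of a) = of a := rfl

theorem reverse_mul (w w' : Word A) : reverse (w * w') = reverse w' * reverse w := by
  rw [reverse, map_mul, unop_mul]
  rfl

theorem reverse_reverse (w : Word A) : reverse (reverse w) = w := by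
  induction w using FreeSemigroup.recOnMul with
  | ih1 a => rfl
  | ih2 a w _ ih => rw [reverse_mul, reverse_mul, ih, reverse_of, reverse_of]

theorem letters_reverse (w : Word A) : letters (reverse w) = (letters w).reverse := by
  induction w using FreeSemigroup.recOnMul with
  | ih1 a => rfl
  | ih2 a w _ ih => rw [reverse_mul, letters_mul, ih, letters_mul, List.reverse_append]; rfl

theorem length_reverse (w : Word A) : (reverse w).length = w.length := by
  rw [← length_letters, letters_reverse, List.length_reverse, length_letters]

/-- The homomorphism `w ↦ φ (reverse w)` to the opposite semigroup. It turns statements about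
prefixes into statements about suffixes. -/
def mirror {S : Type*} [Semigroup S] (φ : Word A →ₙ* S) : Word A →ₙ* Sᵐᵒᵖ where
  toFun w := op (φ (reverse w))
  map_mul' w w' := by rw [reverse_mul, map_mul, op_mul]

theorem mirror_reverse {S : Type*} [Semigroup S] (φ : Word A →ₙ* S) (w : Word A) :
    mirror φ (reverse w) = op (φ w) :=
  congrArg (fun w => op (φ w)) (reverse_reverse w)

/-- The congruence that relates the mirror images of the words related by `c`. -/
def reverseCon (c : Con (Word A)) : Con (Word A) where
  r w w' := c (reverse w) (reverse w')
  iseqv := ⟨fun _ => c.refl _, c.symm, c.trans⟩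
  mul' {w x y z} hwx hyz := by
    rw [reverse_mul, reverse_mul]
    exact c.mul hyz hwx

theorem reverseCon_rel {c : Con (Word A)} {w w' : Word A} :
    reverseCon c w w' ↔ c (reverse w) (reverse w') := Iff.rfl

theorem reverseCon_reverseCon (c : Con (Word A)) : reverseCon (reverseCon c) = c := by
  ext w w'
  rw [reverseCon_rel, reverseCon_rel, reverse_reverse, reverse_reverse]

theorem reverseCon_mono {c d : Con (Word A)} (h : c ≤ d) : reverseCon c ≤ reverseCon d :=
  fun _ _ hw => h hw

variable (A) in
/-- The congruence that relates two words if they have the same first `n` letters; words with fewer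
than `n` letters are related only to themselves. -/
def prefixCon (n : ℕ) : Con (Word A) where
  r w w' := (letters w).take n = (letters w').take n
  iseqv := ⟨fun _ => rfl, Eq.symm, Eq.trans⟩
  mul' {w x y z} hwx hyz := by
    have hlen : n - (letters w).length = n - (letters x).length := by
      have := congrArg List.length hwx
      rw [List.length_take, List.length_take] at this
      omega
    have htake := congrArg (List.take (n - (letters x).length)) hyz
    rw [List.take_take, List.take_take, Nat.min_eq_left (Nat.sub_le _ _)] at htake
    rw [letters_mul, letters_mul, List.take_append, List.take_append, hwx, hlen, htake]

variable (A) in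
/-- The congruence that relates two words if they have the same last `n` letters; words with fewer
than `n` letters are related only to themselves. -/
def suffixCon (n : ℕ) : Con (Word A) := reverseCon (prefixCon A n)

theorem prefixCon_rel {n : ℕ} {w w' : Word A} :
    prefixCon A n w w' ↔ (letters w).take n = (letters w').take n := Iff.rfl

theorem suffixCon_rel {n : ℕ} {w w' : Word A} :
    suffixCon A n w w' ↔ prefixCon A n (reverse w) (reverse w') := Iff.rfl

theorem eq_of_prefixCon_of_length_lt {n : ℕ} {w w' : Word A} (h : prefixCon A n w w')
    (hw : w.length < n) : w = w' := by
  have hlen := congrArg List.length (prefixCon_rel.1 h)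
  rw [List.length_take, List.length_take, length_letters, length_letters] at hlen
  rw [prefixCon_rel, List.take_of_length_le (by rw [length_letters]; omega),
    List.take_of_length_le (by rw [length_letters]; omega)] at h
  exact letters_injective h

theorem prefixCon_of_mul {m n : ℕ} {u v w : Word A} (h : prefixCon A m (u * v) (u * w))
    (hm : u.length + n ≤ m) : prefixCon A n v w := by
  rw [prefixCon_rel, letters_mul, letters_mul, List.take_append, List.take_append,
    List.append_cancel_left_eq, length_letters] at h
  have htake := congrArg (List.take n) h
  rwa [List.take_take, List.take_take, Nat.min_eq_left (by omega)] at htake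

theorem prefixCon_mul_right {n : ℕ} {w : Word A} (hw : n ≤ w.length) (w' : Word A) :
    prefixCon A n (w * w') w := by
  rw [prefixCon_rel, letters_mul, List.take_append_of_le_length hw]

theorem exists_length_eq_forall_prefix {n : ℕ} (hn : n ≠ 0) {w : Word A} (hw : n ≤ w.length) :
    ∃ p : Word A, p.length = n ∧ ∀ v, prefixCon A n v w → letters p <+: letters v := by
  have hlen : ((letters w).take n).length = n := by
    rw [List.length_take, length_letters, Nat.min_eq_left hw]
  obtain ⟨p, hp⟩ := exists_letters_eq (l := (letters w).take n)
    (List.ne_nil_of_length_pos (by omega))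
  refine ⟨p, by rw [← length_letters, hp, hlen], fun v hv => ?_⟩
  rw [hp, ← prefixCon_rel.1 hv]
  exact List.take_prefix n _

theorem prefix_of_prefixCon {n : ℕ} {u v x y : Word A} (h : prefixCon A n (u * v) (x * y))
    (hu : u.length ≤ n) (hux : u.length ≤ x.length) : letters u <+: letters x := by
  refine List.prefix_of_prefix_length_le (l₃ := letters (x * y)) ?_ ⟨letters y, rfl⟩ hux
  have htake : letters u <+: (letters (u * v)).take n :=
    List.prefix_take_iff.2 ⟨⟨letters v, rfl⟩, hu⟩
  rw [prefixCon_rel.1 h] at htake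
  exact htake.trans (List.take_prefix n _)

theorem hasIdempotentFactor_map {S : Type*} [Semigroup S] [Finite S] (φ : Word A →ₙ* S)
    {w : Word A} (hw : Nat.card S < w.length) : HasIdempotentFactor (φ w) := by
  let p (i : ℕ) : Word A := ⟨w.head, w.tail.take i⟩
  have hp (i : ℕ) : letters (p i) = (letters w).take (i + 1) := rfl
  have hlen {i : ℕ} (hi : i < w.length) : (p i).length = i + 1 := by
    rw [← length_letters, hp, List.length_take, length_letters, Nat.min_eq_left hi]
  obtain ⟨i, j, hij, hj, hφ⟩ : ∃ i j, i < j ∧ j < w.length ∧ φ (p i) = φ (p j) := by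
    by_contra! hne
    have hinj : Injective fun i : Fin w.length => φ (p i) := fun i j h => by
      by_contra hij
      rcases lt_or_gt_of_ne hij with hij | hij
      · exact hne i j hij j.2 h
      · exact hne j i hij i.2 h.symm
    have hcard := Nat.card_le_card_of_injective _ hinj
    rw [Nat.card_fin] at hcard
    omega
  obtain ⟨r, hr⟩ : ∃ r, p j = p i * r := exists_eq_mul_of_prefix
    (by rw [hp, hp]; exact List.take_prefix_take_left (by omega))
    (by rw [hlen hj, hlen (hij.trans hj)]; omega)
  obtain ⟨q, hq⟩ : ∃ q, w = p i * q := exists_eq_mul_of_prefix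
    (List.take_prefix _ _ : (letters w).take (i + 1) <+: _) (by rw [hlen (hij.trans hj)]; omega)
  obtain ⟨f, hf, hidem⟩ := exists_isIdempotentElem_mem (s := {s | φ (p i) * s = φ (p i)})
    ⟨φ r, by rw [Set.mem_ofPred_eq, ← map_mul, ← hr, hφ]⟩
    fun s (hs : _ = _) t (ht : _ = _) => by rw [Set.mem_ofPred_eq, ← mul_assoc, hs, ht]
  exact ⟨φ (p i), f, φ q, hidem, by rw [hf, ← map_mul, ← hq]⟩

theorem exists_con_and_le_length (c : Con (Word A)) {w : Word A} (hw : c (w * w) w) (n : ℕ) :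
    ∃ w', c w' w ∧ n ≤ w'.length := by
  induction n with
  | zero => exact ⟨w, c.refl w, Nat.zero_le _⟩
  | succ n ih =>
    obtain ⟨w', hw', hn⟩ := ih
    refine ⟨w' * w, c.trans (c.mul hw' (c.refl w)) hw, ?_⟩
    rw [length_mul]
    exact Nat.add_le_add hn (Nat.le_add_left 1 _)

theorem finite_quotient_prefixCon_inf_suffixCon [Finite A] (n : ℕ) :
    Finite (prefixCon A n ⊓ suffixCon A n).Quotient := by
  let ends (w : Word A) : {l : List A | l.length ≤ n} × {l : List A | l.length ≤ n} :=
    (⟨(letters w).take n, List.length_take_le n _⟩,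
      ⟨(letters (reverse w)).take n, List.length_take_le n _⟩)
  have : Finite {l : List A | l.length ≤ n} := List.finite_length_le A n
  refine .of_injective (Quotient.lift ends fun w w' h => ?_) ?_
  · exact Prod.ext (Subtype.ext h.1) (Subtype.ext h.2)
  · rintro ⟨w⟩ ⟨w'⟩ (h : ends w = ends w')
    obtain ⟨hpre, hsuf⟩ := Prod.ext_iff.1 h
    exact Quotient.sound ⟨congrArg Subtype.val hpre, congrArg Subtype.val hsuf⟩

theorem isFiniteLocallyTrivial_quotient {A : Type u} [Finite A] [Nonempty A] (n : ℕ) :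
    IsFiniteLocallyTrivial (prefixCon A n ⊓ suffixCon A n).Quotient := by
  set c := prefixCon A n ⊓ suffixCon A n
  refine ⟨finite_quotient_prefixCon_inf_suffixCon n, ⟨(of (Classical.arbitrary A) : Word A)⟩, ?_⟩
  rintro ⟨w⟩ he _ ⟨⟨s⟩, rfl⟩
  obtain ⟨w', hw', hn⟩ := exists_con_and_le_length c ((Con.eq c).1 he) n
  have hlong : c (w' * s * w') w' := by
    refine ⟨?_, ?_⟩
    · rw [mul_assoc]
      exact prefixCon_mul_right hn _
    · refine suffixCon_rel.2 ?_
      rw [reverse_mul]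
      exact prefixCon_mul_right (by rwa [length_reverse]) _
  refine (Con.eq c).2 (c.trans (c.trans ?_ hlong) hw')
  exact c.symm (c.mul (c.mul hw' (c.refl s)) hw')

end Word

namespace IsFiniteLocalGroup

open Word

variable {A : Type*} {S : Type u} [Semigroup S]

theorem exists_isIdempotentElem_mul_map_eq (hS : IsFiniteLocalGroup S) (φ : Word A →ₙ* S)
    {w : Word A} (hw : Nat.card S < w.length) :
    ∃ e, IsIdempotentElem e ∧ ∀ v, prefixCon A (Nat.card S + 1) v w → e * φ v = φ v := by
  have := hS.1
  obtain ⟨p, hlen, hp⟩ := exists_length_eq_forall_prefix (Nat.succ_ne_zero (Nat.card S)) hw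
  obtain ⟨e, he, hep⟩ :=
    hS.exists_isIdempotentElem_mul_eq (hasIdempotentFactor_map φ (hlen ▸ Nat.lt_succ_self _))
  refine ⟨e, he, fun v hv => ?_⟩
  rcases eq_or_exists_eq_mul_of_prefix (hp v hv) with rfl | ⟨r, rfl⟩
  · exact hep
  · rw [map_mul, ← mul_assoc, hep]

theorem exists_isIdempotentElem_map_mul_eq (hS : IsFiniteLocalGroup S) (φ : Word A →ₙ* S)
    {w : Word A} (hw : Nat.card S < w.length) :
    ∃ e, IsIdempotentElem e ∧ ∀ v, suffixCon A (Nat.card S + 1) v w → φ v * e = φ v := by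
  have hcard : Nat.card Sᵐᵒᵖ = Nat.card S := (Nat.card_congr opEquiv).symm
  obtain ⟨e, he, hev⟩ := hS.op.exists_isIdempotentElem_mul_map_eq (mirror φ) (w := reverse w)
    (by rwa [length_reverse, hcard])
  refine ⟨e.unop, congrArg unop he, fun v hv => op_injective ?_⟩
  rw [hcard] at hev
  rw [op_mul, op_unop, ← mirror_reverse, hev _ hv]

theorem map_eq_of_map_mul_eq (hS : IsFiniteLocalGroup S) (φ : Word A →ₙ* S)
    {u v w : Word A} (h : φ (u * v) = φ (u * w))
    (hvw : prefixCon A (Nat.card S + 1) v w) : φ v = φ w := by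
  by_cases hv : v.length < Nat.card S + 1
  · rw [eq_of_prefixCon_of_length_lt hvw hv]
  · obtain ⟨e, he, hev⟩ := hS.exists_isIdempotentElem_mul_map_eq φ (w := v) (by omega)
    rw [map_mul, map_mul] at h
    exact hS.mul_left_cancel he (hev v (Con.refl _ v)) (hev w (Con.symm _ hvw)) h

theorem equidivisibleAt_map_of_prefixCon (hS : IsFiniteLocalGroup S) (φ : Word A →ₙ* S)
    {u v x y : Word A} (h : φ (u * v) = φ (x * y))
    (hp : prefixCon A (2 * (Nat.card S + 1)) (u * v) (x * y))
    (hshort : u.length ≤ Nat.card S ∨ x.length ≤ Nat.card S) :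
    EquidivisibleAt (φ u) (φ v) (φ x) (φ y) := by
  wlog hux : u.length ≤ x.length generalizing u v x y
  · exact (this h.symm (Con.symm _ hp) hshort.symm (by omega)).symm
  have hu : u.length ≤ Nat.card S := by omega
  rcases eq_or_exists_eq_mul_of_prefix (prefix_of_prefixCon hp (by omega) hux) with
    rfl | ⟨t, rfl⟩
  · exact Or.inl ⟨rfl, hS.map_eq_of_map_mul_eq φ h (prefixCon_of_mul hp (by omega))⟩
  · rw [mul_assoc] at h hp
    refine Or.inr (Or.inl ⟨φ t, (map_mul φ u t).symm, ?_⟩)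
    rw [← map_mul]
    exact hS.map_eq_of_map_mul_eq φ h (prefixCon_of_mul hp (by omega))

theorem equidivisibleAt_map_of_suffixCon (hS : IsFiniteLocalGroup S) (φ : Word A →ₙ* S)
    {u v x y : Word A} (h : φ (u * v) = φ (x * y))
    (hs : suffixCon A (2 * (Nat.card S + 1)) (u * v) (x * y))
    (hshort : v.length ≤ Nat.card S ∨ y.length ≤ Nat.card S) :
    EquidivisibleAt (φ u) (φ v) (φ x) (φ y) := by
  have hcard : Nat.card Sᵐᵒᵖ = Nat.card S := (Nat.card_congr opEquiv).symm
  rw [suffixCon_rel, reverse_mul, reverse_mul, ← hcard] at hs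
  have hmirror := hS.op.equidivisibleAt_map_of_prefixCon (mirror φ)
    (by rw [← reverse_mul, ← reverse_mul, mirror_reverse, mirror_reverse, h]) hs
    (by rwa [length_reverse, length_reverse, hcard])
  simp only [mirror_reverse] at hmirror
  exact hmirror.of_op

/-- If one of the four words is short, then the common prefix or suffix determines how the two
factorizations overlap; otherwise all four values lie in the minimal ideal. -/
theorem equidivisibleAt_map (hS : IsFiniteLocalGroup S) (φ : Word A →ₙ* S)
    {u v x y : Word A} (h : φ (u * v) = φ (x * y))
    (hps : (prefixCon A (2 * (Nat.card S + 1)) ⊓ suffixCon A (2 * (Nat.card S + 1)))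
      (u * v) (x * y)) :
    EquidivisibleAt (φ u) (φ v) (φ x) (φ y) := by
  have := hS.1
  by_cases hux : u.length ≤ Nat.card S ∨ x.length ≤ Nat.card S
  · exact hS.equidivisibleAt_map_of_prefixCon φ h hps.1 hux
  by_cases hvy : v.length ≤ Nat.card S ∨ y.length ≤ Nat.card S
  · exact hS.equidivisibleAt_map_of_suffixCon φ h hps.2 hvy
  push Not at hux hvy
  rw [map_mul, map_mul] at h
  exact hS.equidivisibleAt_of_hasIdempotentFactor (hasIdempotentFactor_map φ hvy.1)
    (hasIdempotentFactor_map φ hux.2) h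

theorem exists_forall_mul_ne (hS : IsFiniteLocalGroup S) (hcs : ¬ IsFiniteCompletelySimple S) :
    ∃ s : S, ∀ a b, a * b ≠ s := by
  have := hS.1
  by_contra! hdecomp
  have hword (n : ℕ) (s : S) : ∃ w : Word S, n < w.length ∧ FreeSemigroup.lift id w = s := by
    induction n generalizing s with
    | zero => exact ⟨of s, Nat.zero_lt_one, rfl⟩
    | succ n ih =>
      obtain ⟨a, b, rfl⟩ := hdecomp s
      obtain ⟨w, hw, rfl⟩ := ih a
      refine ⟨w * of b, ?_, by rw [map_mul, lift_of, id]⟩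
      rw [length_mul, length_of]
      exact Nat.add_lt_add_right hw 1
  refine hcs (hS.isFiniteCompletelySimple_iff.2 fun k => ?_)
  obtain ⟨w, hw, rfl⟩ := hword (Nat.card S) k
  exact hasIdempotentFactor_map _ hw

end IsFiniteLocalGroup

theorem IsFiniteLocallyTrivial.map_eq_of_prefixCon_inf_suffixCon {A : Type*} {S : Type u}
    [Semigroup S] (hS : IsFiniteLocallyTrivial S) (φ : Word A →ₙ* S) {w w' : Word A}
    (h : (Word.prefixCon A (Nat.card S + 1) ⊓ Word.suffixCon A (Nat.card S + 1)) w w') :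
    φ w = φ w' := by
  by_cases hw : w.length < Nat.card S + 1
  · rw [Word.eq_of_prefixCon_of_length_lt h.1 hw]
  have hLG := hS.isFiniteLocalGroup
  obtain ⟨e, he, hew⟩ := hLG.exists_isIdempotentElem_mul_map_eq φ (w := w) (by omega)
  obtain ⟨f, hf, hwf⟩ := hLG.exists_isIdempotentElem_map_mul_eq φ (w := w) (by omega)
  have hew' := hew w' (Con.symm _ h.1)
  have hwf' := hwf w' (Con.symm _ h.2)
  calc φ w = φ w * (f * φ w' * f) := by
        rw [hS.mul_mul_eq_self hf, hwf w (Con.refl _ w)]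
    _ = φ w * φ w' := by rw [mul_assoc, hwf', ← mul_assoc, hwf w (Con.refl _ w)]
    _ = e * φ w * e * φ w' := by rw [hew w (Con.refl _ w), mul_assoc, hew']
    _ = φ w' := by rw [hS.mul_mul_eq_self he, hew']

/-- The congruence `c` identifies no letter with any other word. -/
def SeparatesLetters {A : Type*} (c : Con (Word A)) : Prop :=
  ∀ (a : A) (w : Word A), c (of a) w → w = of a

namespace SeparatesLetters

open Word

variable {A : Type*} {c d : Con (Word A)}

theorem mono (hc : SeparatesLetters c) (h : d ≤ c) : SeparatesLetters d :=
  fun a w hw => hc a w (h hw)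

theorem reverseCon (hc : SeparatesLetters c) : SeparatesLetters (reverseCon c) := fun a w hw => by
  rw [← reverse_reverse w, hc a _ hw, reverse_of]

theorem mul_ne_of (hc : SeparatesLetters c) (p q : c.Quotient) (a : A) :
    p * q ≠ (of a : Word A) := by
  obtain ⟨w, rfl⟩ := Quotient.exists_rep p
  obtain ⟨w', rfl⟩ := Quotient.exists_rep q
  exact fun h => Word.mul_ne_of w w' a (hc a _ (c.symm ((Con.eq c).1 h)))

theorem of_inj (hc : SeparatesLetters c) {a b : A}
    (h : ((of a : Word A) : c.Quotient) = (of b : Word A)) : a = b :=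
  (congrArg FreeSemigroup.head (hc a _ ((Con.eq c).1 h))).symm

theorem eq_of_equidivisibleAt_of_left (hc : SeparatesLetters c) {a b : A} {v y : c.Quotient}
    (h : EquidivisibleAt ((of a : Word A) : c.Quotient) v (of b : Word A) y) : a = b ∧ v = y := by
  rcases h with ⟨hab, hvy⟩ | ⟨t, hb, -⟩ | ⟨t, ha, -⟩
  · exact ⟨hc.of_inj hab, hvy⟩
  · exact absurd hb (hc.mul_ne_of _ _ _)
  · exact absurd ha (hc.mul_ne_of _ _ _)

theorem eq_of_equidivisibleAt_of_right (hc : SeparatesLetters c) {a b : A} {u x : c.Quotient}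
    (h : EquidivisibleAt u ((of a : Word A) : c.Quotient) x (of b : Word A)) : a = b ∧ u = x := by
  rcases h with ⟨hux, hab⟩ | ⟨t, -, ha⟩ | ⟨t, -, hb⟩
  · exact ⟨hc.of_inj hab, hux⟩
  · exact absurd ha.symm (hc.mul_ne_of _ _ _)
  · exact absurd hb.symm (hc.mul_ne_of _ _ _)

theorem le_prefixCon_succ (hc : SeparatesLetters c) {n : ℕ}
    (h : ∀ a b w w', c (of a * w) (of b * w') → a = b ∧ prefixCon A n w w') :
    c ≤ prefixCon A (n + 1) := by
  intro w w' hww'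
  rcases eq_of_or_eq_of_mul w with ⟨a, rfl⟩ | ⟨a, r, rfl⟩
  · rw [hc a w' hww']
    exact Con.refl _ _
  rcases eq_of_or_eq_of_mul w' with ⟨b, rfl⟩ | ⟨b, r', rfl⟩
  · rw [hc b _ (c.symm hww')]
    exact Con.refl _ _
  obtain ⟨rfl, hr⟩ := h a b r r' hww'
  exact congrArg (List.cons a) hr

theorem le_suffixCon_succ (hc : SeparatesLetters c) {n : ℕ}
    (h : ∀ a b w w', c (w * of a) (w' * of b) → a = b ∧ suffixCon A n w w') :
    c ≤ suffixCon A (n + 1) := by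
  rw [← reverseCon_reverseCon c]
  refine reverseCon_mono (hc.reverseCon.le_prefixCon_succ fun a b w w' hw => ?_)
  rw [reverseCon_rel, reverse_mul, reverse_mul] at hw
  obtain ⟨hab, hs⟩ := h a b _ _ hw
  rw [suffixCon_rel, reverse_reverse, reverse_reverse] at hs
  exact ⟨hab, hs⟩

end SeparatesLetters


theorem forall_or_forall_of_monotone {α : Type*} [Preorder α] [IsCodirectedOrder α] {p q : α → Prop}
    (hp : Monotone p) (hq : Monotone q) (h : ∀ a, p a ∨ q a) : (∀ a, p a) ∨ ∀ a, q a := by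
  by_contra! hcon
  obtain ⟨⟨a, ha⟩, b, hb⟩ := hcon
  obtain ⟨c, hca, hcb⟩ := exists_le_le a b
  exact (h c).elim (fun hc => ha (hp hca hc)) fun hc => hb (hq hcb hc)

/-- The homomorphism on `M ⧸ c` induced by a homomorphism on `M` whose kernel contains `c`. It is
`Con.lift` for semigroups. -/
def conLift {M N : Type*} [Semigroup M] [Semigroup N] (c : Con M) (f : M →ₙ* N)
    (h : c ≤ Con.ker f) : c.Quotient →ₙ* N where
  toFun := Quotient.lift f fun _ _ hxy => h hxy
  map_mul' := by
    rintro ⟨x⟩ ⟨y⟩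
    exact map_mul f x y

namespace Pseudovariety

variable {V : Pseudovariety.{u}} {A : Type u}

theorem mem_of_injective {S T : Type u} [Semigroup S] [Semigroup T] [Nonempty S] (f : S →ₙ* T)
    (hf : Injective f) (hT : V.Mem T) : V.Mem S := by
  let e : S ≃* MulHom.srange f := MulEquiv.ofBijective f.srangeRestrict
    ⟨fun _ _ h => hf (congrArg Subtype.val h), f.srangeRestrict_surjective⟩
  have hrange : V.Mem (MulHom.srange f) :=
    V.subsemigroup_mem T _ (e.symm.surjective.nonempty) hT
  exact V.image_mem _ _ e.symm.toMulHom e.symm.surjective hrange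

theorem mem_of_surjective_of_le_ker {S : Type u} [Semigroup S] {f : FreeSemigroup A →ₙ* S}
    (hf : Surjective f) (c : V.FreeCon A) (h : c.1 ≤ Con.ker f) : V.Mem S := by
  refine V.image_mem _ _ (conLift c.1 f h) (fun s => ?_) c.2
  obtain ⟨w, rfl⟩ := hf s
  exact ⟨(w : c.1.Quotient), rfl⟩

/-- `FreeCon V A` is ordered by inclusion of congruences, so the smaller congruences have the larger
quotients. -/
instance : Preorder (V.FreeCon A) := Preorder.lift Subtype.val

section Nonempty

variable [Nonempty A]

/-- The kernel of a homomorphism from `A⁺` to a member of `V`. -/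
def FreeCon.ker {S : Type u} [Semigroup S] (hS : V.Mem S) (f : FreeSemigroup A →ₙ* S) :
    V.FreeCon A :=
  ⟨Con.ker f, by
    have : Nonempty (Con.ker f).Quotient :=
      ⟨((of (Classical.arbitrary A) : FreeSemigroup A) : (Con.ker f).Quotient)⟩
    refine mem_of_injective (conLift (Con.ker f) f le_rfl) ?_ hS
    rintro ⟨x⟩ ⟨y⟩ h
    exact Quotient.sound h⟩

theorem FreeCon.exists_le {ι : Type} [Finite ι] (c : ι → V.FreeCon A) :
    ∃ d : V.FreeCon A, ∀ i, d ≤ c i :=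
  ⟨FreeCon.ker (V.pi_mem ι _ fun i => (c i).2) (MulHom.pi fun i => Con.mkMulHom (c i).1),
    fun i _ _ h => (Con.eq _).1 (congrFun h i)⟩

instance : Nonempty (V.FreeCon A) :=
  (FreeCon.exists_le (Empty.elim : Empty → V.FreeCon A)).nonempty

instance : IsCodirectedOrder (V.FreeCon A) where
  directed c d := by
    obtain ⟨e, he⟩ := FreeCon.exists_le fun b : Bool => bif b then c else d
    exact ⟨e, he true, he false⟩

theorem exists_separatesLetters [Finite A] {S : Type u} [Semigroup S] (hS : V.Mem S) {s : S}
    (hs : ∀ a b, a * b ≠ s) : ∃ c : V.FreeCon A, SeparatesLetters c.1 := by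
  classical
  let mark (a : A) : FreeSemigroup A →ₙ* S :=
    FreeSemigroup.lift fun b => if b = a then s else s * s
  obtain ⟨c, hc⟩ := Finite.exists_ge fun a : A => FreeCon.ker hS (mark a)
  refine ⟨c, fun a w h => ?_⟩
  have hmark : mark a (of a) = mark a w := hc a h
  rw [lift_of, if_pos rfl] at hmark
  rcases Word.eq_of_or_eq_of_mul w with ⟨b, rfl⟩ | ⟨b, r, rfl⟩
  · rw [lift_of] at hmark
    split_ifs at hmark with hb
    · rw [hb]
    · exact absurd hmark.symm (hs s s)
  · rw [map_mul] at hmark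
    exact absurd hmark.symm (hs _ _)

end Nonempty

section FreePro

/-- The canonical projection of the free pro-`V` semigroup onto `A⁺ ⧸ c`. -/
def proj (c : V.FreeCon A) : V.freePro A →ₙ* c.1.Quotient :=
  (Pi.evalMulHom (fun c : V.FreeCon A => c.1.Quotient) c).comp (MulMemClass.subtype (V.freePro A))

theorem freePro_ext {x y : V.freePro A} (h : ∀ c, proj c x = proj c y) : x = y :=
  Subtype.ext (funext h)

theorem conTransition_proj {c d : V.FreeCon A} (h : c ≤ d) (x : V.freePro A) :
    conTransition h (proj c x) = proj d x :=
  x.2 c d h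

theorem proj_eq_of_le {c d : V.FreeCon A} (h : c ≤ d) {x : V.freePro A} {w : FreeSemigroup A}
    (hw : proj c x = (w : c.1.Quotient)) : proj d x = (w : d.1.Quotient) := by
  rw [← conTransition_proj h, hw]
  rfl

theorem exists_proj_eq (c : V.FreeCon A) (x : V.freePro A) :
    ∃ w : FreeSemigroup A, proj c x = (w : c.1.Quotient) := by
  obtain ⟨w, hw⟩ := Quotient.exists_rep (proj c x)
  exact ⟨w, hw.symm⟩

variable [Nonempty A]

/-- Compactness of the free pro-`V` semigroup: the limit is taken along an ultrafilter that contains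
all lower sections of `FreeCon V A`. -/
theorem exists_forall_proj_eq {ι : Type*} [Finite ι] {P : V.FreeCon A → Set (ι → FreeSemigroup A)}
    (hne : ∀ c, (P c).Nonempty) (hmono : Monotone P) :
    ∃ x : ι → V.freePro A, ∀ c, ∃ w ∈ P c, ∀ i, proj c (x i) = (w i : c.1.Quotient) := by
  choose w hw using hne
  obtain ⟨U, hU⟩ := Ultrafilter.exists_le (Filter.atBot : Filter (V.FreeCon A))
  have hlim (i : ι) (c : V.FreeCon A) :
      ∃ q : c.1.Quotient, ∀ᶠ d in U, (w d i : c.1.Quotient) = q := by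
    have := V.finite_of_mem _ c.2
    exact Ultrafilter.eventually_exists_iff.1 (.of_forall fun d => ⟨_, rfl⟩)
  choose q hq using hlim
  refine ⟨fun i => ⟨q i, fun c d hcd => ?_⟩, fun c => ?_⟩
  · obtain ⟨e, hc, hd⟩ := ((hq i c).and (hq i d)).exists
    rw [← hc, ← hd]
    rfl
  · obtain ⟨d, hd, hdc⟩ :=
      ((Filter.eventually_all.2 fun i => hq i c).and (hU (Filter.Iic_mem_atBot c))).exists
    exact ⟨w d, hmono hdc (hw d), fun i => (hd i).symm⟩

theorem exists_mul_eq_of_forall_proj {u v x y : V.freePro A}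
    (h : ∀ c, ∃ t, proj c u * t = proj c x ∧ proj c v = t * proj c y) :
    ∃ t, u * t = x ∧ v = t * y := by
  let factors (c : V.FreeCon A) : Set (Unit → FreeSemigroup A) :=
    {w | proj c u * (w () : c.1.Quotient) = proj c x ∧
      proj c v = (w () : c.1.Quotient) * proj c y}
  have hne (c : V.FreeCon A) : (factors c).Nonempty := by
    obtain ⟨t, ht⟩ := h c
    obtain ⟨w, rfl⟩ := Quotient.exists_rep t
    exact ⟨fun _ => w, ht⟩
  have hmono : Monotone factors := by
    rintro c d hcd w ⟨hx, hv⟩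
    refine ⟨?_, ?_⟩
    · rw [← conTransition_proj hcd, ← conTransition_proj hcd x, ← hx, map_mul]
      rfl
    · rw [← conTransition_proj hcd, ← conTransition_proj hcd y, hv, map_mul]
      rfl
  obtain ⟨t, ht⟩ := exists_forall_proj_eq hne hmono
  have hproj (c : V.FreeCon A) :
      proj c u * proj c (t ()) = proj c x ∧ proj c v = proj c (t ()) * proj c y := by
    obtain ⟨w, hw, htw⟩ := ht c
    rwa [htw]
  exact ⟨t (), freePro_ext fun c => (hproj c).1, freePro_ext fun c => (hproj c).2⟩

theorem equidivisibleAt_freePro_iff {u v x y : V.freePro A} :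
    EquidivisibleAt u v x y ↔
      ∀ c, EquidivisibleAt (proj c u) (proj c v) (proj c x) (proj c y) := by
  refine ⟨fun h c => h.map (proj c), fun h => ?_⟩
  have heq : Monotone fun c : V.FreeCon A => proj c u = proj c x ∧ proj c v = proj c y := by
    rintro c d hcd ⟨hux, hvy⟩
    simp only [← conTransition_proj hcd, hux, hvy, and_self]
  have hfactor (u v x y : V.freePro A) : Monotone fun c : V.FreeCon A =>
      ∃ t, proj c u * t = proj c x ∧ proj c v = t * proj c y := by
    rintro c d hcd ⟨t, hx, hv⟩
    refine ⟨conTransition hcd t, ?_, ?_⟩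
    · rw [← conTransition_proj hcd, ← map_mul, hx, conTransition_proj]
    · rw [← conTransition_proj hcd, hv, map_mul, conTransition_proj]
  rcases forall_or_forall_of_monotone heq ((hfactor u v x y).sup (hfactor x y u v)) h with h | h
  · exact Or.inl ⟨freePro_ext fun c => (h c).1, freePro_ext fun c => (h c).2⟩
  rcases forall_or_forall_of_monotone (hfactor u v x y) (hfactor x y u v) h with h | h
  · exact Or.inr (Or.inl (exists_mul_eq_of_forall_proj h))
  · exact Or.inr (Or.inr (exists_mul_eq_of_forall_proj h))

theorem isEquidivisible_freePro_iff :
    IsEquidivisible (V.freePro A) ↔ ∀ c : V.FreeCon A, ∃ d : V.FreeCon A,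
      ∀ u v x y : FreeSemigroup A, d.1 (u * v) (x * y) →
        EquidivisibleAt (u : c.1.Quotient) v x y := by
  constructor
  · intro hE c
    by_contra! hcon
    let bad (d : V.FreeCon A) : Set (Fin 4 → FreeSemigroup A) :=
      {w | d.1 (w 0 * w 1) (w 2 * w 3) ∧
        ¬ EquidivisibleAt (w 0 : c.1.Quotient) (w 1) (w 2) (w 3)}
    have hbad (d : V.FreeCon A) : (bad d).Nonempty := by
      obtain ⟨u, v, x, y, h⟩ := hcon d
      exact ⟨![u, v, x, y], h⟩
    obtain ⟨f, hf⟩ := exists_forall_proj_eq hbad fun d e hde w h => ⟨hde h.1, h.2⟩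
    have hmul : f 0 * f 1 = f 2 * f 3 := freePro_ext fun d => by
      obtain ⟨w, ⟨hw, -⟩, hfw⟩ := hf d
      simp only [map_mul, hfw]
      exact (Con.eq d.1).2 hw
    obtain ⟨w, ⟨-, hw⟩, hfw⟩ := hf c
    have hc := equidivisibleAt_freePro_iff.1 (hE _ _ _ _ hmul) c
    simp only [hfw] at hc
    exact hw hc
  · intro h u v x y huv
    refine equidivisibleAt_freePro_iff.2 fun c => ?_
    obtain ⟨d, hd⟩ := h c
    obtain ⟨e, hec, hed⟩ := exists_le_le c d
    obtain ⟨u', hu⟩ := exists_proj_eq e u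
    obtain ⟨v', hv⟩ := exists_proj_eq e v
    obtain ⟨x', hx⟩ := exists_proj_eq e x
    obtain ⟨y', hy⟩ := exists_proj_eq e y
    have he := congrArg (proj e) huv
    rw [map_mul, map_mul, hu, hv, hx, hy] at he
    rw [proj_eq_of_le hec hu, proj_eq_of_le hec hv, proj_eq_of_le hec hx, proj_eq_of_le hec hy]
    exact hd _ _ _ _ (hed ((Con.eq e.1).1 he))

end FreePro

theorem equidivisible_of_forall_isEquidivisible
    (h : ∀ (S : Type u) [Semigroup S], V.Mem S → IsEquidivisible S) : V.Equidivisible :=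
  fun _ _ _ => isEquidivisible_freePro_iff.2 fun c =>
    ⟨c, fun _ _ _ _ huv => h _ c.2 _ _ _ _ ((Con.eq c.1).2 huv)⟩

theorem equidivisible_of_isFiniteCompletelySimple
    (hLG : ∀ (S : Type u) [Semigroup S], V.Mem S → IsFiniteLocalGroup S)
    (hCS : ∀ (S : Type u) [Semigroup S], V.Mem S → IsFiniteCompletelySimple S) :
    V.Equidivisible :=
  equidivisible_of_forall_isEquidivisible fun S _ hS =>
    have hfactor := (hLG S hS).isFiniteCompletelySimple_iff.1 (hCS S hS)
    fun _ v x _ h => (hLG S hS).equidivisibleAt_of_hasIdempotentFactor (hfactor v) (hfactor x) h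

theorem equidivisible_of_isFiniteLocallyTrivial
    (hLG : ∀ (S : Type u) [Semigroup S], V.Mem S → IsFiniteLocalGroup S)
    (hLI : ∀ (S : Type u) [Semigroup S], IsFiniteLocallyTrivial S → V.Mem S) :
    V.Equidivisible := by
  refine fun A _ _ => isEquidivisible_freePro_iff.2 fun c => ?_
  let ends : V.FreeCon A := ⟨_, hLI _ (Word.isFiniteLocallyTrivial_quotient (A := A)
    (2 * (Nat.card c.1.Quotient + 1)))⟩
  obtain ⟨d, hdc, hde⟩ := exists_le_le c ends
  exact ⟨d, fun u v x y h =>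
    (hLG _ c.2).equidivisibleAt_map (Con.mkMulHom c.1) ((Con.eq c.1).2 (hdc h)) (hde h)⟩

theorem exists_separatesLetters_le_prefixCon_inf_suffixCon [Nonempty A]
    (hE : IsEquidivisible (V.freePro A)) (hsep : ∃ c : V.FreeCon A, SeparatesLetters c.1) (n : ℕ) :
    ∃ c : V.FreeCon A, SeparatesLetters c.1 ∧ c.1 ≤ Word.prefixCon A n ⊓ Word.suffixCon A n := by
  induction n with
  | zero =>
    obtain ⟨c, hc⟩ := hsep
    exact ⟨c, hc, fun _ _ _ => ⟨rfl, rfl⟩⟩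
  | succ n ih =>
    obtain ⟨c, hc, hcn⟩ := ih
    obtain ⟨d, hd⟩ := isEquidivisible_freePro_iff.1 hE c
    obtain ⟨e, hec, hed⟩ := exists_le_le c d
    have he := hc.mono hec
    refine ⟨e, he, le_inf (he.le_prefixCon_succ fun a b w w' h => ?_)
      (he.le_suffixCon_succ fun a b w w' h => ?_)⟩
    · obtain ⟨hab, hw⟩ := hc.eq_of_equidivisibleAt_of_left (hd _ _ _ _ (hed h))
      exact ⟨hab, (hcn ((Con.eq c.1).1 hw)).1⟩
    · obtain ⟨hab, hw⟩ := hc.eq_of_equidivisibleAt_of_right (hd _ _ _ _ (hed h))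
      exact ⟨hab, (hcn ((Con.eq c.1).1 hw)).2⟩

theorem Equidivisible.mem_of_isFiniteLocallyTrivial (hE : V.Equidivisible) {T : Type u}
    [Semigroup T] (hT : V.Mem T) {s : T} (hs : ∀ a b, a * b ≠ s) {S : Type u} [Semigroup S]
    (hS : IsFiniteLocallyTrivial S) : V.Mem S := by
  have := hS.1
  have := hS.2.1
  obtain ⟨c, -, hc⟩ := exists_separatesLetters_le_prefixCon_inf_suffixCon (hE S)
    (exists_separatesLetters hT hs) (Nat.card S + 1)
  exact mem_of_surjective_of_le_ker (f := FreeSemigroup.lift id) (fun s => ⟨of s, rfl⟩) c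
    fun _ _ h => hS.map_eq_of_prefixCon_inf_suffixCon _ (hc h)

end Pseudovariety

theorem theoremt (V : Pseudovariety.{u})
    (hV : ∀ (S : Type u) [Semigroup S], V.Mem S → IsFiniteLocalGroup S) :
    V.Equidivisible ↔
      (∀ (S : Type u) [Semigroup S], V.Mem S → IsFiniteCompletelySimple S) ∨
      (∀ (S : Type u) [Semigroup S], IsFiniteLocallyTrivial S → V.Mem S) := by
  constructor
  · intro hE
    by_contra! hcon
    obtain ⟨⟨T, _, hT, hTcs⟩, S, _, hS, hSV⟩ := hcon
    obtain ⟨s, hs⟩ := (hV T hT).exists_forall_mul_ne hTcs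
    exact hSV (hE.mem_of_isFiniteLocallyTrivial hT hs hS)
  · rintro (hCS | hLI)
    · exact Pseudovariety.equidivisible_of_isFiniteCompletelySimple hV hCS
    · exact Pseudovariety.equidivisible_of_isFiniteLocallyTrivial hV hLI
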